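/- Let $G$ be a finite group. Then there exists a finite group $N$ such that (1) $G \cong \operatorname{Out}(N)$, where $\operatorname{Out}(N) = \operatorname{Aut}(N)/\operatorname{Inn}(N)$; (2) $Z(N) = 1$; (3) the only subgroup of $\operatorname{Aut}(N)$ isomorphic to $N$ is $\operatorname{Inn}(N)$, that is, a subgroup $H \le \operatorname{Aut}(N)$ is isomorphic to $N$ if and only if $H = \operatorname{Inn}(N)$; (4) the quotient map $\operatorname{Aut}(N) \to \operatorname{Out}(N)$ has a section that is a group homomorphism $\operatorname{Out}(N) \to \operatorname{Aut}(N)$; (5) $N$ is supersolvable, that is, there is a finite series $1 = N_0 \le N_1 \le \dots \le N_k = N$ of normal subgroups of $N$ with every quotient $N_{i+1}/N_i$ cyclic. -/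

import Mathlib

universe u

/-- The group `Inn(N)` of inner automorphisms of a group `N`, as a subgroup of `Aut(N)`. -/
def InnerAut (N : Type u) [Group N] : Subgroup (MulAut N) :=
  (MulAut.conj : N →* MulAut N).range

instance InnerAut.normal (N : Type u) [Group N] : (InnerAut N).Normal := by
  refine ⟨?_⟩
  rintro _ ⟨x, rfl⟩ f
  refine ⟨f x, ?_⟩
  ext y
  simp [MulAut.mul_apply, MulAut.conj_apply]

/-- The outer automorphism group `Out(N) = Aut(N) / Inn(N)`. -/
abbrev OuterAut (N : Type u) [Group N] : Type u := MulAut N ⧸ InnerAut N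

/-- A group is supersolvable if it has a finite series
`1 = H 0 ≤ H 1 ≤ ... ≤ H n = N` of subgroups, each normal in the whole group `N`,
such that every factor `H (i + 1) / H i` is cyclic. -/
def IsSupersolvable (N : Type u) [Group N] : Prop :=
  ∃ (n : ℕ) (H : Fin (n + 1) → Subgroup N) (_ : ∀ i, (H i).Normal),
    H 0 = ⊥ ∧ H (Fin.last n) = ⊤ ∧
      ∀ i : Fin n, H i.castSucc ≤ H i.succ ∧
        IsCyclic (H i.succ ⧸ (H i.castSucc).subgroupOf (H i.succ))

/-! By Frucht's theorem `G` is the automorphism group of a finite graph `Γ`. For a suitable odd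
prime `p`, let F be the graph group of `Γ`, T the torus of its diagonal automorphisms, and N = F ⋊ T
(`TorusGroup`). The group Aut Γ permutes coordinates on N, and the point is that Aut N = N ⋊ Aut Γ
(`Hol`); the factor Aut Γ is then both Out N and a section.

Everything rests on a regular t in T with t ^ ℓ = 1, where `p` and ℓ are primes not dividing |Aut
Γ|. Such a t fixes only 1 in F and has distinct coordinates, so its centraliser in `Hol` is T, and
the coset Ft consists of conjugates of t.

Let ψ embed N in `Hol`. Coprimality to |Aut Γ| forces ψ(F) = F and sends the ℓ-torsion of T into N,
bijectively modulo F. Hence some element of T goes to a conjugate of t, and ψ(T), which centralises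
it, lies in a conjugate of T. So the image of ψ is N (`range_eq_range_inl`), which characterises Inn
N. If ψ comes from an automorphism of N, an inner correction makes it preserve F and T; it then
permutes the lines of the generators, and commutation recovers adjacency (`exists_torus_iso`).

Supersolvability holds because T acts diagonally. -/

open SemidirectProduct

open scoped commutatorElement

/-! ### Frucht's theorem. -/

section Frucht

variable {G : Type u} [Group G] {n : ℕ} (r : Fin (n + 2) → G)

/-- Vertices are the pairs `(g, i)` of a group element and a layer. Layers `i`, `j` with
`n + 2 ≤ i + j` are completely joined, other pairs of layers are joined by a matching: the layers
`0` and `j` by `g ↦ g * r j`, the others by the identity. -/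
def layerRel (a b : G × Fin (n + 2)) : Prop :=
  n + 2 ≤ (a.2 : ℕ) + b.2 ∨ (a.2 = 0 ∧ b.1 = a.1 * r b.2) ∨ (b.2 = 0 ∧ a.1 = b.1 * r a.2) ∨
    (a.2 ≠ 0 ∧ b.2 ≠ 0 ∧ a.1 = b.1)

def layerGraph : SimpleGraph (G × Fin (n + 2)) where
  Adj a b := a ≠ b ∧ layerRel r a b
  symm := ⟨by
    rintro a b ⟨h, h'⟩
    refine ⟨h.symm, ?_⟩
    unfold layerRel at *
    rcases h' with h' | h' | h' | ⟨h1, h2, h3⟩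
    · exact Or.inl (add_comm (a.2 : ℕ) b.2 ▸ h')
    · exact Or.inr (Or.inr (Or.inl h'))
    · exact Or.inr (Or.inl h')
    · exact Or.inr (Or.inr (Or.inr ⟨h2, h1, h3.symm⟩))⟩
  loopless := ⟨fun a h => h.1 rfl⟩

variable {r}

theorem layerRel_refl (hr : r 0 = 1) (a : G × Fin (n + 2)) : layerRel r a a := by
  unfold layerRel
  by_cases h : a.2 = 0
  · simp [h, hr]
  · simp [h]

theorem layerRel_smul (k : G) (a b : G × Fin (n + 2)) :
    layerRel r (k * a.1, a.2) (k * b.1, b.2) ↔ layerRel r a b := by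
  simp [layerRel, mul_assoc]

/-- Left multiplication as an automorphism of `layerGraph r`. -/
def layerGraphLeftMul : G →* (layerGraph r ≃g layerGraph r) where
  toFun k :=
    { toFun := fun a => (k * a.1, a.2)
      invFun := fun a => (k⁻¹ * a.1, a.2)
      left_inv := fun a => by simp
      right_inv := fun a => by simp
      map_rel_iff' := by
        intro a b
        simp only [layerGraph, Equiv.coe_fn_mk]
        rw [layerRel_smul, Ne, Prod.ext_iff, Ne, Prod.ext_iff]
        simp }
  map_one' := by ext a <;> simp
  map_mul' a b := by ext c <;> simp [mul_assoc]

/-- Passing to closed neighbourhoods lets a layer be treated as joined to itself by the same rule as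
to any other. -/
theorem layerGraph_iso_rel (hr : r 0 = 1) (σ : layerGraph r ≃g layerGraph r)
    (a b : G × Fin (n + 2)) : layerRel r (σ a) (σ b) ↔ layerRel r a b := by
  by_cases h : a = b
  · subst h; simp [layerRel_refl hr]
  · have := σ.map_adj_iff (v := a) (w := b)
    have h' : σ a ≠ σ b := fun e => h (σ.injective e)
    exact (and_iff_right h').symm.trans (this.trans (and_iff_right h))

/-- Layer `i` is completely joined to the `i` layers `j ≥ n + 2 - i`; each other layer contributes
one vertex through its matching. For `|G| ≥ 2` this count increases strictly with `i`, so it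
identifies the layer. -/
theorem card_layerRel [Fintype G] (hr : r 0 = 1) (a : G × Fin (n + 2)) :
    Nat.card {b // layerRel r a b} = a.2 * Fintype.card G + (n + 2 - a.2) := by
  classical
  have key : ∀ j : Fin (n + 2), Fintype.card {h : G // layerRel r a (h, j)} =
      if n + 2 ≤ (a.2 : ℕ) + j then Fintype.card G else 1 := by
    intro j
    split_ifs with hj
    · rw [Fintype.card_subtype]
      simp [layerRel, hj]
    · rw [Fintype.card_eq_one_iff]
      by_cases h0 : a.2 = 0
      · refine ⟨⟨a.1 * r j, by simp [layerRel, h0]⟩, ?_⟩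
        rintro ⟨h, h'⟩
        refine Subtype.ext ?_
        rcases h' with h' | h' | h' | h'
        · exact absurd h' hj
        · exact h'.2
        · obtain ⟨h1, h2⟩ := h'
          simp only at h1 h2
          change h = a.1 * r j
          rw [h2, h1, h0, hr, mul_one, mul_one]
        · exact absurd h0 h'.1
      · by_cases hj0 : j = 0
        · refine ⟨⟨a.1 * (r a.2)⁻¹, by simp [layerRel, hj0]⟩, ?_⟩
          rintro ⟨h, h'⟩
          refine Subtype.ext ?_
          rcases h' with h' | h' | h' | h'
          · exact absurd h' hj
          · exact absurd h'.1 h0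
          · simp [h'.2]
          · exact absurd hj0 h'.2.1
        · refine ⟨⟨a.1, by simp [layerRel, hj0, h0]⟩, ?_⟩
          rintro ⟨h, h'⟩
          refine Subtype.ext ?_
          rcases h' with h' | h' | h' | h'
          · exact absurd h' hj
          · exact absurd h'.1 h0
          · exact absurd h'.1 hj0
          · exact h'.2.2.symm
  let e : {b // layerRel r a b} ≃ Σ j : Fin (n + 2), {h : G // layerRel r a (h, j)} :=
    { toFun := fun b => ⟨b.1.2, b.1.1, b.2⟩
      invFun := fun s => ⟨(s.2.1, s.1), s.2.2⟩
      left_inv := fun b => rfl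
      right_inv := fun s => rfl }
  rw [Nat.card_congr e, Nat.card_eq_fintype_card, Fintype.card_sigma]
  simp_rw [key]
  rw [Finset.sum_ite, Finset.sum_const, Finset.sum_const]
  have h1 : (Finset.univ.filter fun j : Fin (n + 2) => n + 2 ≤ (a.2 : ℕ) + j).card = a.2 := by
    refine Eq.trans ?_ (Fin.card_Iio a.2)
    refine Finset.card_bij' (fun j _ => j.rev) (fun j _ => j.rev) ?_ ?_ ?_ ?_
    · intro j hj
      simp only [Finset.mem_filter, Finset.mem_univ, true_and, Finset.mem_Iio, Fin.lt_def,
        Fin.val_rev] at hj ⊢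
      omega
    · intro j hj
      simp only [Finset.mem_filter, Finset.mem_univ, true_and, Finset.mem_Iio, Fin.lt_def,
        Fin.val_rev] at hj ⊢
      omega
    · simp
    · simp
  have h2 := Finset.card_filter_add_card_filter_not (s := (Finset.univ : Finset (Fin (n + 2))))
    (p := fun j => n + 2 ≤ (a.2 : ℕ) + j)
  rw [h1, Finset.card_univ, Fintype.card_fin] at h2
  rw [h1]
  simp only [smul_eq_mul, mul_one]
  omega

theorem layerGraph_iso_snd [Finite G] [Nontrivial G] (hr : r 0 = 1)
    (σ : layerGraph r ≃g layerGraph r) (a : G × Fin (n + 2)) : (σ a).2 = a.2 := by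
  have := Fintype.ofFinite G
  have h : Nat.card {b // layerRel r a b} = Nat.card {b // layerRel r (σ a) b} :=
    Nat.card_congr (σ.toEquiv.subtypeEquiv fun b => (layerGraph_iso_rel hr σ a b).symm)
  rw [card_layerRel hr, card_layerRel hr] at h
  obtain ⟨m, hm⟩ := Nat.exists_eq_add_of_le (Fintype.one_lt_card (α := G))
  rw [hm] at h
  have h1 := a.2.isLt
  have h2 := (σ a).2.isLt
  have h3 : ∀ i < n + 2, i * (1 + 1 + m) + (n + 2 - i) = i * (m + 1) + (n + 2) := by
    intro i hi
    have : i * (1 + 1 + m) = i * (m + 1) + i := by ring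
    omega
  rw [h3 _ h1, h3 _ h2] at h
  exact Fin.ext (Nat.eq_of_mul_eq_mul_right (Nat.succ_pos m) (Nat.add_right_cancel h)).symm

theorem layerGraphLeftMul_bijective [Finite G] [Nontrivial G] (hr : r 0 = 1)
    (hsurj : ∀ g : G, ∃ j : Fin (n + 2), 1 ≤ (j : ℕ) ∧ (j : ℕ) < n + 1 ∧ r j = g) :
    Function.Bijective (layerGraphLeftMul (r := r)) := by
  constructor
  · intro k k' h
    have := congrArg (fun σ : layerGraph r ≃g layerGraph r => (σ (1, 0)).1) h
    simpa [layerGraphLeftMul] using this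
  intro σ
  have hσ : ∀ g j, σ (g, j) = ((σ (g, j)).1, j) := fun g j =>
    Prod.ext rfl (layerGraph_iso_snd hr σ (g, j))
  have h01 : (1 : Fin (n + 2)) ≠ 0 := by simp
  -- Layer `n + 1` is the only one completely joined to layer `1`; the identity matchings make `σ`
  -- agree on layers `1, ..., n`.
  have hone : ∀ g (j : Fin (n + 2)), 1 ≤ (j : ℕ) → (j : ℕ) < n + 1 →
      (σ (g, j)).1 = (σ (g, 1)).1 := by
    intro g j hj hj'
    have hj0 : j ≠ 0 := by rintro rfl; simp at hj
    have h := (layerGraph_iso_rel hr σ (g, 1) (g, j)).2 (by simp [layerRel, hj0])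
    rw [hσ g j, hσ g 1] at h
    simp only [layerRel, h01, hj0, Fin.val_one] at h
    rcases h with h | h | h | h
    · omega
    · exact absurd h.1 id
    · exact absurd h.1 id
    · exact h.2.2.symm
  have hzero : ∀ g (j : Fin (n + 2)), (σ (g * r j, j)).1 = (σ (g, 0)).1 * r j := by
    intro g j
    have h := (layerGraph_iso_rel hr σ (g, 0) (g * r j, j)).2 (by simp [layerRel])
    rw [hσ (g * r j) j, hσ g 0] at h
    simp only [layerRel, Fin.val_zero, zero_add] at h
    rcases h with h | h | h | h
    · have := j.isLt; omega
    · exact h.2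
    · obtain ⟨h1, h2⟩ := h
      subst h1
      rw [h2, hr]; simp
    · exact absurd rfl h.1
  have h10 : ∀ g, (σ (g, 1)).1 = (σ (g, 0)).1 := by
    intro g
    obtain ⟨j, h1, h2, h3⟩ := hsurj 1
    have := hzero g j
    rw [h3, mul_one, mul_one] at this
    rw [← hone g j h1 h2, this]
  -- So `σ` on layer `0` commutes with right multiplications, hence is a left multiplication.
  have hmul : ∀ g k, (σ (g * k, 0)).1 = (σ (g, 0)).1 * k := by
    intro g k
    obtain ⟨j, h1, h2, rfl⟩ := hsurj k
    rw [← hzero, ← h10, hone _ j h1 h2]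
  refine ⟨(σ (1, 0)).1, ?_⟩
  refine RelIso.ext ?_
  rintro ⟨g, j⟩
  rw [hσ g j]
  refine Prod.ext ?_ rfl
  have h := hzero (g * (r j)⁻¹) j
  rw [inv_mul_cancel_right] at h
  have h' := hmul 1 (g * (r j)⁻¹)
  rw [one_mul] at h'
  rw [h, h', mul_assoc, inv_mul_cancel_right]
  rfl

end Frucht

/-- Frucht's theorem: every finite group is the automorphism group of a finite graph. -/
theorem exists_graph_aut_equiv (G : Type u) [Group G] [Finite G] :
    ∃ (V : Type u) (_ : Finite V) (Γ : SimpleGraph V), Nonempty (G ≃* (Γ ≃g Γ)) := by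
  cases subsingleton_or_nontrivial G with
  | inl h =>
    have : Unique G := uniqueOfSubsingleton 1
    have : Subsingleton ((⊥ : SimpleGraph PUnit.{u + 1}) ≃g (⊥ : SimpleGraph PUnit.{u + 1})) :=
      ⟨fun a b => RelIso.ext fun _ => Subsingleton.elim _ _⟩
    have : Unique ((⊥ : SimpleGraph PUnit.{u + 1}) ≃g (⊥ : SimpleGraph PUnit.{u + 1})) :=
      uniqueOfSubsingleton 1
    exact ⟨PUnit, inferInstance, ⊥, ⟨MulEquiv.ofUnique⟩⟩
  | inr h =>
    obtain ⟨n, ⟨e⟩⟩ := Finite.exists_equiv_fin G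
    -- Layers `1, ..., n` enumerate `G`; the value `1` on layers `0` and `n + 1` is a filler, though
    -- `r 0 = 1` is needed later.
    let r : Fin (n + 2) → G := fun j =>
      if h : 1 ≤ (j : ℕ) ∧ (j : ℕ) < n + 1 then e.symm ⟨j - 1, by omega⟩ else 1
    have hr : r 0 = 1 := by simp [r]
    have hsurj : ∀ g : G, ∃ j : Fin (n + 2), 1 ≤ (j : ℕ) ∧ (j : ℕ) < n + 1 ∧ r j = g := by
      intro g
      have := (e g).isLt
      refine ⟨⟨e g + 1, by omega⟩, by simp, by simp, ?_⟩
      simp [r]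
    exact ⟨G × Fin (n + 2), inferInstance, layerGraph r,
      ⟨MulEquiv.ofBijective layerGraphLeftMul (layerGraphLeftMul_bijective hr hsurj)⟩⟩

/-! ### The graph group and its generators. -/

/-- The free nilpotent group of class two and exponent `p` on the vertices of `Γ`, modulo the
commutators of non-adjacent vertices: elements are pairs of a vector and an alternating form
supported on the edges. -/
@[ext]
structure GraphGroup (p : ℕ) {V : Type u} (Γ : SimpleGraph V) where
  x : V → ZMod p
  y : V → V → ZMod p
  antisymm : ∀ u v, y u v = -y v u
  supp : ∀ u v, ¬ Γ.Adj u v → y u v = 0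

namespace GraphGroup

variable {p : ℕ} {V : Type u} {Γ : SimpleGraph V}

open Classical in
/-- The indicator of the edges. -/
noncomputable def wt (p : ℕ) (Γ : SimpleGraph V) (u v : V) : ZMod p := if Γ.Adj u v then 1 else 0

theorem wt_comm (u v : V) : wt p Γ u v = wt p Γ v u := by
  classical
  unfold wt
  exact if_congr (Γ.adj_comm u v) rfl rfl

theorem wt_of_adj {u v : V} (h : Γ.Adj u v) : wt p Γ u v = 1 := if_pos h

theorem wt_of_not_adj {u v : V} (h : ¬ Γ.Adj u v) : wt p Γ u v = 0 := if_neg h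

/-- The cocycle is alternating, so inverses and powers are taken coordinatewise and the exponent
divides `p`. -/
noncomputable instance : Mul (GraphGroup p Γ) where
  mul a b :=
    { x := fun u => a.x u + b.x u
      y := fun u v => a.y u v + b.y u v + wt p Γ u v * (a.x u * b.x v - b.x u * a.x v)
      antisymm := fun u v => by rw [a.antisymm, b.antisymm, wt_comm]; ring
      supp := fun u v h => by rw [a.supp u v h, b.supp u v h, wt_of_not_adj h]; ring }

instance : One (GraphGroup p Γ) where
  one := { x := fun _ => 0, y := fun _ _ => 0, antisymm := by simp, supp := by simp }

instance : Inv (GraphGroup p Γ) where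
  inv a :=
    { x := fun u => -a.x u
      y := fun u v => -a.y u v
      antisymm := fun u v => by rw [a.antisymm]
      supp := fun u v h => by rw [a.supp u v h, neg_zero] }

@[simp] theorem mul_x (a b : GraphGroup p Γ) (u : V) : (a * b).x u = a.x u + b.x u := rfl

@[simp] theorem mul_y (a b : GraphGroup p Γ) (u v : V) :
    (a * b).y u v = a.y u v + b.y u v + wt p Γ u v * (a.x u * b.x v - b.x u * a.x v) := rfl

@[simp] theorem one_x (u : V) : (1 : GraphGroup p Γ).x u = 0 := rfl

@[simp] theorem one_y (u v : V) : (1 : GraphGroup p Γ).y u v = 0 := rfl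

@[simp] theorem inv_x (a : GraphGroup p Γ) (u : V) : (a⁻¹).x u = -a.x u := rfl

@[simp] theorem inv_y (a : GraphGroup p Γ) (u v : V) : (a⁻¹).y u v = -a.y u v := rfl

theorem ext' {a b : GraphGroup p Γ} (hx : ∀ u, a.x u = b.x u) (hy : ∀ u v, a.y u v = b.y u v) :
    a = b :=
  GraphGroup.ext (funext hx) (funext fun u => funext (hy u))

noncomputable instance : Group (GraphGroup p Γ) :=
  Group.ofLeftAxioms
    (fun a b c => ext' (fun u => by simp only [mul_x]; ring)
      (fun u v => by simp only [mul_x, mul_y]; ring))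
    (fun a => ext' (fun u => by simp) (fun u v => by simp))
    (fun a => ext' (fun u => by simp)
      (fun u v => by simp only [mul_y, inv_y, inv_x, one_y]; ring))

@[simp] theorem pow_x (a : GraphGroup p Γ) (n : ℕ) (u : V) : (a ^ n).x u = n * a.x u := by
  induction n with
  | zero => simp
  | succ n ih => rw [pow_succ, mul_x, ih]; push_cast; ring

@[simp] theorem pow_y (a : GraphGroup p Γ) (n : ℕ) (u v : V) :
    (a ^ n).y u v = n * a.y u v := by
  induction n with
  | zero => simp
  | succ n ih => rw [pow_succ, mul_y, ih, pow_x, pow_x]; push_cast; ring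

theorem pow_char (a : GraphGroup p Γ) : a ^ p = 1 :=
  ext' (fun u => by simp) (fun u v => by simp)

theorem commutator_x (a b : GraphGroup p Γ) (u : V) : (⁅a, b⁆).x u = 0 := by
  simp only [commutatorElement_def, mul_x, inv_x]; ring

theorem commutator_y (a b : GraphGroup p Γ) (u v : V) :
    (⁅a, b⁆).y u v = 2 * (wt p Γ u v * (a.x u * b.x v - b.x u * a.x v)) := by
  simp only [commutatorElement_def, mul_x, mul_y, inv_x, inv_y]; ring

instance [Finite V] [NeZero p] : Finite (GraphGroup p Γ) :=
  Finite.of_injective (fun a : GraphGroup p Γ => (a.x, a.y)) fun _ _ h =>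
    GraphGroup.ext (congrArg Prod.fst h) (congrArg Prod.snd h)

/-! ### Generators -/

open Classical in
/-- The generator of a vertex. -/
noncomputable def gen (v : V) : GraphGroup p Γ where
  x := Pi.single v 1
  y := fun _ _ => 0
  antisymm := by simp
  supp := by simp

/-- The form `wt * (a ∧ b)` as a central element. -/
noncomputable def wedge (a b : V → ZMod p) : GraphGroup p Γ where
  x := fun _ => 0
  y := fun u v => wt p Γ u v * (a u * b v - b u * a v)
  antisymm := fun u v => by rw [wt_comm]; ring
  supp := fun u v h => by rw [wt_of_not_adj h, zero_mul]

theorem gen_x_self (v : V) : (gen v : GraphGroup p Γ).x v = 1 := by simp [gen]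

theorem gen_x_of_ne {v u : V} (h : u ≠ v) : (gen v : GraphGroup p Γ).x u = 0 := by
  simp [gen, h]

@[simp] theorem gen_y (v a b : V) : (gen v : GraphGroup p Γ).y a b = 0 := rfl

/-- The central generator of a pair of vertices. -/
noncomputable def edge (u v : V) : GraphGroup p Γ :=
  wedge (gen u : GraphGroup p Γ).x (gen v : GraphGroup p Γ).x

@[simp] theorem edge_x (u v w : V) : (edge u v : GraphGroup p Γ).x w = 0 := rfl

theorem edge_y (u v a b : V) : (edge u v : GraphGroup p Γ).y a b =
    wt p Γ a b * ((gen u : GraphGroup p Γ).x a * (gen v : GraphGroup p Γ).x b -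
      (gen v : GraphGroup p Γ).x a * (gen u : GraphGroup p Γ).x b) := rfl

variable [Fact p.Prime]

theorem two_ne_zero_zmod (hp : 2 < p) : (2 : ZMod p) ≠ 0 := by
  intro h
  have := (ZMod.natCast_eq_zero_iff 2 p).1 (by exact_mod_cast h)
  exact absurd (Nat.le_of_dvd two_pos this) (not_le.2 hp)

theorem mem_closure_edge [Finite V] (hp : 2 < p) {a : GraphGroup p Γ} (ha : ∀ u, a.x u = 0) :
    a ∈ Subgroup.closure (Set.range fun e : V × V => (edge e.1 e.2 : GraphGroup p Γ)) := by
  classical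
  have := Fintype.ofFinite V
  have h2 := two_ne_zero_zmod hp
  set K := Subgroup.closure (Set.range fun e : V × V => (edge e.1 e.2 : GraphGroup p Γ))
  let S (y : V → V → ZMod p) : Prop := ∃ f ∈ K, (∀ u, f.x u = 0) ∧ f.y = y
  have hadd : ∀ y z, S y → S z → S (y + z) := by
    rintro _ _ ⟨f, hf, hf', rfl⟩ ⟨g, hg, hg', rfl⟩
    refine ⟨f * g, K.mul_mem hf hg, fun u => by simp [hf', hg'], ?_⟩
    funext u v
    simp [hf', hg']
  -- Each edge occurs in both orientations with equal contributions, hence the division by two.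
  have hsum : S (∑ u, ∑ v, (a.y u v / 2) • (edge u v : GraphGroup p Γ).y) := by
    have h0 : S 0 := ⟨1, K.one_mem, by simp, rfl⟩
    refine Finset.sum_induction _ S hadd h0 fun u _ => ?_
    refine Finset.sum_induction _ S hadd h0 fun v _ => ?_
    refine ⟨edge u v ^ (a.y u v / 2).val,
      K.pow_mem (Subgroup.subset_closure ⟨(u, v), rfl⟩) _, by simp, ?_⟩
    funext b c
    simp
  obtain ⟨f, hf, hf', hfy⟩ := hsum
  convert hf
  refine ext' (fun u => by rw [ha, hf']) fun b c => ?_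
  rw [hfy]
  by_cases hbc : Γ.Adj b c
  · simp only [Finset.sum_apply, Pi.smul_apply, edge_y, wt_of_adj hbc, gen, Pi.single_apply,
      smul_eq_mul, mul_sub, Finset.sum_sub_distrib, mul_ite, mul_one, mul_zero]
    simp
    rw [a.antisymm c b]
    field_simp
    ring
  · rw [a.supp _ _ hbc]
    simp [edge_y, wt_of_not_adj hbc]

/-- The commutator is twice the cocycle, and `2` is invertible modulo the exponent. -/
theorem edge_eq_commutator_pow (hp : 2 < p) (u v : V) :
    (edge u v : GraphGroup p Γ) = ⁅(gen u : GraphGroup p Γ), gen v⁆ ^ (2⁻¹ : ZMod p).val := by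
  have h2 := two_ne_zero_zmod hp
  refine ext' (fun w => by simp [commutator_x]) fun b c => ?_
  rw [pow_y, commutator_y, edge_y, ZMod.natCast_zmod_val, inv_mul_cancel_left₀ h2]

theorem edge_mem_of_gen_mem (hp : 2 < p) {K : Subgroup (GraphGroup p Γ)} (hK : ∀ v, gen v ∈ K)
    (u v : V) : edge u v ∈ K := by
  rw [edge_eq_commutator_pow hp]
  exact K.pow_mem (K.mul_mem (K.mul_mem (K.mul_mem (hK u) (hK v)) (K.inv_mem (hK u)))
    (K.inv_mem (hK v))) _

theorem exists_mem_x_eq [Finite V] {K : Subgroup (GraphGroup p Γ)} (hK : ∀ v, gen v ∈ K)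
    (a : GraphGroup p Γ) : ∃ k ∈ K, k.x = a.x := by
  classical
  have := Fintype.ofFinite V
  have hsum : ∃ k ∈ K, k.x = ∑ v, a.x v • (gen v : GraphGroup p Γ).x := by
    refine Finset.sum_induction _ (fun x => ∃ k ∈ K, k.x = x) ?_ ⟨1, K.one_mem, rfl⟩ ?_
    · rintro _ _ ⟨f, hf, rfl⟩ ⟨g, hg, rfl⟩
      exact ⟨f * g, K.mul_mem hf hg, rfl⟩
    · intro v _
      exact ⟨gen v ^ (a.x v).val, K.pow_mem (hK v) _, by funext u; simp⟩
  obtain ⟨k, hk, hk'⟩ := hsum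
  refine ⟨k, hk, ?_⟩
  rw [hk']
  funext u
  simp [gen, Pi.single_apply]

theorem eq_top_of_gen_mem [Finite V] (hp : 2 < p) {K : Subgroup (GraphGroup p Γ)}
    (hK : ∀ v, gen v ∈ K) : K = ⊤ := by
  refine (Subgroup.eq_top_iff' K).2 fun a => ?_
  obtain ⟨k, hk, hk'⟩ := exists_mem_x_eq hK a
  have h : k⁻¹ * a ∈ K := by
    refine (Subgroup.closure_le K).2 ?_ (mem_closure_edge hp fun u => ?_)
    · rintro _ ⟨e, rfl⟩
      exact edge_mem_of_gen_mem hp hK _ _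
    · simp [hk']
  simpa using K.mul_mem hk h

theorem hom_ext [Finite V] (hp : 2 < p) {H : Type*} [Group H] {α β : GraphGroup p Γ →* H}
    (h : ∀ v, α (gen v) = β (gen v)) : α = β :=
  MonoidHom.eq_of_eqOn_top fun a _ => by
    have : α.eqLocus β = ⊤ := eq_top_of_gen_mem hp h
    exact (this ▸ Subgroup.mem_top a : a ∈ α.eqLocus β)

/-- Endomorphisms preserve the subgroup `x = 0`, which is the commutator subgroup. -/
theorem map_x_eq_zero [Finite V] (hp : 2 < p) (α : GraphGroup p Γ →* GraphGroup p Γ)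
    {a : GraphGroup p Γ} (ha : ∀ u, a.x u = 0) (u : V) : (α a).x u = 0 := by
  let X : GraphGroup p Γ →* Multiplicative (ZMod p) :=
    { toFun := fun f => Multiplicative.ofAdd (f.x u)
      map_one' := rfl
      map_mul' := fun f g => rfl }
  have h : a ∈ (X.comp α).ker := by
    refine (Subgroup.closure_le _).2 ?_ (mem_closure_edge hp ha)
    rintro _ ⟨e, rfl⟩
    change edge e.1 e.2 ∈ (X.comp α).ker
    rw [edge_eq_commutator_pow hp]
    refine Subgroup.pow_mem _ ?_ _
    rw [MonoidHom.mem_ker, map_commutatorElement, commutatorElement_eq_one_iff_commute]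
    exact Commute.all _ _
  exact h

end GraphGroup

/-! ### Actions of the torus and of the graph automorphisms. -/

namespace GraphGroup

variable {p : ℕ} {V : Type u} {Γ : SimpleGraph V}

/-- The diagonal automorphisms of the graph group. -/
noncomputable def torusAct (p : ℕ) (Γ : SimpleGraph V) :
    (V → (ZMod p)ˣ) →* MulAut (GraphGroup p Γ) where
  toFun t :=
    { toFun := fun a =>
        { x := fun u => t u * a.x u
          y := fun u v => t u * t v * a.y u v
          antisymm := fun u v => by rw [a.antisymm]; ring
          supp := fun u v h => by rw [a.supp u v h, mul_zero] }
      invFun := fun a =>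
        { x := fun u => (t u)⁻¹.1 * a.x u
          y := fun u v => (t u)⁻¹.1 * (t v)⁻¹.1 * a.y u v
          antisymm := fun u v => by rw [a.antisymm]; ring
          supp := fun u v h => by rw [a.supp u v h, mul_zero] }
      left_inv := fun a => ext' (fun u => by simp)
        (fun u v => by
          have h := mul_mul_mul_comm (t u)⁻¹.1 (t v)⁻¹.1 (t u) (t v)
          rw [Units.inv_mul, Units.inv_mul, one_mul] at h
          simp only [← mul_assoc] at h ⊢
          rw [h, one_mul])
      right_inv := fun a => ext' (fun u => by simp)
        (fun u v => by
          have h := mul_mul_mul_comm (t u : ZMod p) (t v) (t u)⁻¹.1 (t v)⁻¹.1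
          rw [Units.mul_inv, Units.mul_inv, one_mul] at h
          simp only [← mul_assoc] at h ⊢
          rw [h, one_mul])
      map_mul' := fun a b => ext' (fun u => by simp only [mul_x]; ring)
        (fun u v => by simp only [mul_y]; ring) }
  map_one' := by ext1 a; exact ext' (fun u => by simp) (fun u v => by simp)
  map_mul' s t := by
    ext1 a
    refine ext' (fun u => ?_) (fun u v => ?_)
    · simp [mul_assoc]
    · simp only [Pi.mul_apply, Units.val_mul, MulEquiv.coe_mk, Equiv.coe_fn_mk, MulAut.mul_apply]
      ring

@[simp] theorem torusAct_x (t : V → (ZMod p)ˣ) (a : GraphGroup p Γ) (u : V) :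
    (torusAct p Γ t a).x u = t u * a.x u := rfl

@[simp] theorem torusAct_y (t : V → (ZMod p)ˣ) (a : GraphGroup p Γ) (u v : V) :
    (torusAct p Γ t a).y u v = t u * t v * a.y u v := rfl

/-- The action of the automorphisms of the graph on the graph group. -/
noncomputable def isoAct (p : ℕ) (Γ : SimpleGraph V) : (Γ ≃g Γ) →* MulAut (GraphGroup p Γ) where
  toFun σ :=
    { toFun := fun a =>
        { x := fun u => a.x (σ.symm u)
          y := fun u v => a.y (σ.symm u) (σ.symm v)
          antisymm := fun u v => a.antisymm _ _
          supp := fun u v h => a.supp _ _ (by rwa [σ.symm.map_adj_iff]) }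
      invFun := fun a =>
        { x := fun u => a.x (σ u)
          y := fun u v => a.y (σ u) (σ v)
          antisymm := fun u v => a.antisymm _ _
          supp := fun u v h => a.supp _ _ (by rwa [σ.map_adj_iff]) }
      left_inv := fun a => ext' (fun u => by simp) (fun u v => by simp)
      right_inv := fun a => ext' (fun u => by simp) (fun u v => by simp)
      map_mul' := fun a b => ext' (fun u => rfl) (fun u v => by
        have h : wt p Γ (σ.symm u) (σ.symm v) = wt p Γ u v := by
          by_cases h : Γ.Adj u v
          · rw [wt_of_adj h, wt_of_adj (σ.symm.map_adj_iff.2 h)]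
          · rw [wt_of_not_adj h, wt_of_not_adj (by rwa [σ.symm.map_adj_iff])]
        simp only [mul_y, h]) }
  map_one' := by ext1 a; rfl
  map_mul' s t := by ext1 a; rfl

@[simp] theorem isoAct_x (σ : Γ ≃g Γ) (a : GraphGroup p Γ) (u : V) :
    (isoAct p Γ σ a).x u = a.x (σ.symm u) := rfl

theorem isoAct_gen (σ : Γ ≃g Γ) (v : V) : isoAct p Γ σ (gen v) = gen (σ v) := by
  refine ext' (fun u => ?_) (fun u w => rfl)
  rw [isoAct_x]
  by_cases h : u = σ v
  · subst h
    rw [σ.symm_apply_apply, gen_x_self, gen_x_self]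
  · rw [gen_x_of_ne h, gen_x_of_ne]
    rintro rfl
    exact h (σ.apply_symm_apply u).symm

/-- The action of the automorphisms of the graph on the torus. -/
def isoTorus (p : ℕ) (Γ : SimpleGraph V) : (Γ ≃g Γ) →* MulAut (V → (ZMod p)ˣ) where
  toFun σ :=
    { toFun := fun t u => t (σ.symm u)
      invFun := fun t u => t (σ u)
      left_inv := fun t => by funext u; simp
      right_inv := fun t => by funext u; simp
      map_mul' := fun a b => rfl }
  map_one' := by ext1 a; rfl
  map_mul' s t := by ext1 a; rfl

@[simp] theorem isoTorus_apply (σ : Γ ≃g Γ) (t : V → (ZMod p)ˣ) (u : V) :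
    isoTorus p Γ σ t u = t (σ.symm u) := rfl

theorem torusAct_injective : Function.Injective (torusAct p Γ) := by
  intro s t h
  funext u
  have := congrArg (fun α : MulAut (GraphGroup p Γ) => (α (gen u)).x u) h
  simpa [gen_x_self, Units.ext_iff] using this

end GraphGroup

/-! ### The semidirect products and regular elements of the torus. -/

/-- The graph group extended by the group of diagonal automorphisms. -/
abbrev TorusGroup (p : ℕ) {V : Type u} (Γ : SimpleGraph V) : Type u :=
  GraphGroup p Γ ⋊[GraphGroup.torusAct p Γ] (V → (ZMod p)ˣ)

namespace TorusGroup

open GraphGroup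

variable {p : ℕ} {V : Type u} {Γ : SimpleGraph V}

/-- The action of the automorphisms of the graph on the extended graph group. -/
noncomputable def isoAut (p : ℕ) (Γ : SimpleGraph V) : (Γ ≃g Γ) →* MulAut (TorusGroup p Γ) where
  toFun σ := SemidirectProduct.congr (isoAct p Γ σ) (isoTorus p Γ σ) fun _ => by ext1 a; rfl
  map_one' := by ext1 a; rfl
  map_mul' s t := by ext1 a; rfl

@[simp] theorem isoAut_left (σ : Γ ≃g Γ) (a : TorusGroup p Γ) :
    (isoAut p Γ σ a).left = isoAct p Γ σ a.left := rfl

@[simp] theorem isoAut_right (σ : Γ ≃g Γ) (a : TorusGroup p Γ) :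
    (isoAut p Γ σ a).right = isoTorus p Γ σ a.right := rfl

/-- The extended graph group with the automorphisms of the graph adjoined. -/
abbrev Hol (p : ℕ) {V : Type u} (Γ : SimpleGraph V) : Type u :=
  TorusGroup p Γ ⋊[isoAut p Γ] (Γ ≃g Γ)

instance (N G : Type*) [Group N] [Group G] [Finite N] [Finite G] (φ : G →* MulAut N) :
    Finite (N ⋊[φ] G) := Finite.of_equiv _ SemidirectProduct.equivProd.symm

/-- The unipotent radical. -/
noncomputable def uni : GraphGroup p Γ →* Hol p Γ := inl.comp inl

/-- The torus. -/
noncomputable def tor : (V → (ZMod p)ˣ) →* Hol p Γ := inl.comp inr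

theorem uni_torusAct (t : V → (ZMod p)ˣ) (a : GraphGroup p Γ) :
    uni (torusAct p Γ t a) = tor t * uni a * (tor t)⁻¹ := by
  simp only [uni, tor, MonoidHom.comp_apply, inl_aut, map_mul, map_inv]

/-- An element of the torus without eigenvalue one on the graph group and with trivial stabiliser
in the permutation group of the vertices. -/
structure IsRegular (t : V → (ZMod p)ˣ) : Prop where
  ne_one : ∀ u, t u ≠ 1
  mul_ne_one : ∀ u v, t u * t v ≠ 1
  injective : Function.Injective t

theorem IsRegular.eq_one_of_torusAct_eq [Fact p.Prime] {t : V → (ZMod p)ˣ} (ht : IsRegular t)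
    {a : GraphGroup p Γ} (h : torusAct p Γ t a = a) : a = 1 := by
  refine ext' (fun u => ?_) (fun u v => ?_)
  · have hx : (t u : ZMod p) * a.x u = a.x u := congrFun (congrArg GraphGroup.x h) u
    by_contra hne
    refine ht.ne_one u (Units.ext ?_)
    exact mul_right_cancel₀ hne (hx.trans (one_mul _).symm)
  · have hx : (t u : ZMod p) * t v * a.y u v = a.y u v :=
      congrFun (congrFun (congrArg GraphGroup.y h) u) v
    by_contra hne
    refine ht.mul_ne_one u v (Units.ext ?_)
    exact mul_right_cancel₀ hne (hx.trans (one_mul _).symm)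

/-- The centraliser of a regular element of the torus is the torus. -/
theorem IsRegular.mem_range_tor [Fact p.Prime] {t : V → (ZMod p)ˣ} (ht : IsRegular t)
    {m : Hol p Γ} (h : Commute m (tor t)) : m ∈ (tor : (V → (ZMod p)ˣ) →* Hol p Γ).range := by
  obtain ⟨⟨a, s⟩, σ⟩ := m
  have h1 := congrArg (fun m : Hol p Γ => m.left.left) h
  have h2 := congrArg (fun m : Hol p Γ => m.left.right) h
  simp [tor] at h1 h2
  -- The torus component of the commutation says that `σ` fixes `t`, whose coordinates are distinct.
  have hσ : σ = 1 := by
    refine RelIso.ext fun v => ?_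
    have h3 := congrFun (mul_left_cancel (h2.trans (mul_comm _ _))) (σ v)
    rw [isoTorus_apply, σ.symm_apply_apply] at h3
    exact (ht.injective h3).symm
  have ha : a = 1 := ht.eq_one_of_torusAct_eq h1.symm
  exact ⟨s, by rw [hσ, ha]; rfl⟩

/-- Every element of the coset of a regular element `t` of the torus is conjugate to `t`. -/
theorem IsRegular.exists_conj_eq [Finite V] [Fact p.Prime] {t : V → (ZMod p)ˣ} (ht : IsRegular t)
    (a : GraphGroup p Γ) : ∃ f, uni f * tor t * (uni f)⁻¹ = (uni a * tor t : Hol p Γ) := by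
  -- A Lang-type argument: since `t` has no nontrivial fixed point, `f ↦ f * t(f)⁻¹` is injective,
  -- hence surjective by finiteness.
  have hinj : Function.Injective fun f : GraphGroup p Γ => f * torusAct p Γ t f⁻¹ := by
    intro f g h
    have h' : torusAct p Γ t (g⁻¹ * f) = g⁻¹ * f := by
      simp only [map_mul, map_inv] at h ⊢
      rw [mul_inv_eq_iff_eq_mul] at h
      rw [eq_comm, inv_mul_eq_iff_eq_mul, ← mul_assoc]
      exact h
    exact (inv_mul_eq_one.1 (ht.eq_one_of_torusAct_eq h')).symm
  obtain ⟨f, hf⟩ := Finite.surjective_of_injective hinj a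
  refine ⟨f, ?_⟩
  rw [← hf, map_mul, uni_torusAct]
  simp [mul_assoc]

end TorusGroup

/-! ### Embeddings of `TorusGroup` into `Hol`. -/

namespace TorusGroup

open GraphGroup

variable {p : ℕ} {V : Type u} {Γ : SimpleGraph V}

instance [Finite V] : Finite (Γ ≃g Γ) :=
  Finite.of_injective (fun σ : Γ ≃g Γ => (σ : V → V)) DFunLike.coe_injective

/-- Elements of order prime to the order of the automorphism group of the graph. -/
theorem eq_inl_left_of_pow_eq_one {k : ℕ} (hk : (Nat.card (Γ ≃g Γ)).Coprime k)
    {m : Hol p Γ} (hm : m ^ k = 1) : m = inl m.left := by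
  have h : m.right ^ k = 1 := by
    have := congrArg (rightHom : Hol p Γ →* _) hm
    rwa [map_pow, map_one] at this
  have h1 : m.right = 1 := orderOf_eq_one_iff.1
    (Nat.eq_one_of_dvd_coprimes hk (orderOf_dvd_natCard _) (orderOf_dvd_of_pow_eq_one h))
  exact SemidirectProduct.ext rfl h1

theorem left_right_pow_eq_one {k : ℕ} (hk : (Nat.card (Γ ≃g Γ)).Coprime k)
    {m : Hol p Γ} (hm : m ^ k = 1) : m.left.right ^ k = 1 := by
  rw [eq_inl_left_of_pow_eq_one hk hm, ← map_pow, ← map_one inl] at hm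
  have := congrArg (rightHom : TorusGroup p Γ →* _) (inl_injective hm)
  rwa [map_pow, map_one] at this

theorem torus_pow_char [Fact p.Prime] (t : V → (ZMod p)ˣ) : t ^ p = t := by
  funext u
  exact Units.ext (by simp)

variable [Fact p.Prime] {ψ : TorusGroup p Γ →* Hol p Γ}

/-- The image has exponent `p`, so its graph component vanishes by coprimality, and its torus
component `s` satisfies `1 = s ^ p = s`. -/
theorem exists_map_inl_eq_uni (hp : (Nat.card (Γ ≃g Γ)).Coprime p) (ψ : TorusGroup p Γ →* Hol p Γ)
    (a : GraphGroup p Γ) : ∃ b, ψ (inl a) = uni b := by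
  have h : ψ (inl a) ^ p = 1 := by rw [← map_pow, ← map_pow, pow_char, map_one, map_one]
  have h1 := left_right_pow_eq_one hp h
  rw [torus_pow_char] at h1
  refine ⟨(ψ (inl a)).left.left, ?_⟩
  conv_lhs => rw [eq_inl_left_of_pow_eq_one hp h]
  exact congrArg inl (SemidirectProduct.ext rfl h1)

variable [Finite V]

theorem exists_uni_eq_map_inl (hp : (Nat.card (Γ ≃g Γ)).Coprime p) (hψ : Function.Injective ψ)
    (b : GraphGroup p Γ) : ∃ a, ψ (inl a) = uni b := by
  choose β hβ using exists_map_inl_eq_uni hp ψ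
  have hinj : Function.Injective β := by
    intro a a' h
    refine inl_injective (hψ ?_)
    rw [hβ, hβ, h]
  obtain ⟨a, rfl⟩ := Finite.surjective_of_injective hinj b
  exact ⟨a, hβ a⟩

/-- An embedding of the extended graph group maps the torus to a conjugate of the torus. -/
theorem exists_conj_map_inr (hp : (Nat.card (Γ ≃g Γ)).Coprime p) {ℓ : ℕ}
    (hl : (Nat.card (Γ ≃g Γ)).Coprime ℓ) {t : V → (ZMod p)ˣ} (ht : IsRegular t) (htl : t ^ ℓ = 1)
    (hψ : Function.Injective ψ) :
    ∃ f : GraphGroup p Γ, ∀ s, ∃ s', (uni f)⁻¹ * ψ (inr s) * uni f = tor s' := by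
  have hpow : ∀ s : V → (ZMod p)ˣ, s ^ ℓ = 1 → ψ (inr s) ^ ℓ = 1 := fun s hs => by
    rw [← map_pow, ← map_pow, hs, map_one, map_one]
  -- Only the `ℓ`-torsion is used: the order of the whole torus need not be prime to that of the
  -- graph automorphism group.
  let θ : {s : V → (ZMod p)ˣ // s ^ ℓ = 1} → {s : V → (ZMod p)ˣ // s ^ ℓ = 1} := fun s =>
    ⟨(ψ (inr s.1)).left.right, left_right_pow_eq_one hl (hpow s.1 s.2)⟩
  have hθ : Function.Injective θ := by
    intro s s' h
    have h1 : (ψ (inr s.1)).left.right = (ψ (inr s'.1)).left.right := congrArg Subtype.val h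
    have h2 := eq_inl_left_of_pow_eq_one hl (hpow s.1 s.2)
    have h3 := eq_inl_left_of_pow_eq_one hl (hpow s'.1 s'.2)
    have h4 : ψ (inr (s.1 * s'.1⁻¹)) =
        uni ((ψ (inr s.1)).left * (ψ (inr s'.1)).left⁻¹).left := by
      rw [map_mul, map_inv, map_mul, map_inv]
      conv_lhs => rw [h2, h3, ← map_inv, ← map_mul]
      refine congrArg inl (SemidirectProduct.ext rfl ?_)
      rw [mul_right, inv_right, h1, mul_inv_cancel]
      rfl
    -- Equal torus components put the image of the quotient of `s` and `s'` in the unipotent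
    -- radical, which is the image of the graph group; that group meets the torus trivially.
    obtain ⟨a, ha⟩ := exists_uni_eq_map_inl hp hψ
      ((ψ (inr s.1)).left * (ψ (inr s'.1)).left⁻¹).left
    have h5 := congrArg SemidirectProduct.right (hψ (h4.trans ha.symm))
    exact Subtype.ext (mul_inv_eq_one.1 h5)
  obtain ⟨⟨s, hs⟩, h⟩ := Finite.surjective_of_injective hθ ⟨t, htl⟩
  have h1 : (ψ (inr s)).left.right = t := congrArg Subtype.val h
  have h2 : ψ (inr s) = uni (ψ (inr s)).left.left * tor t := by
    conv_lhs => rw [eq_inl_left_of_pow_eq_one hl (hpow s hs)]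
    rw [uni, tor, MonoidHom.comp_apply, MonoidHom.comp_apply, ← map_mul, ← h1,
      inl_left_mul_inr_right]
  obtain ⟨f, hf⟩ := ht.exists_conj_eq (Γ := Γ) (ψ (inr s)).left.left
  refine ⟨f, fun s' => ?_⟩
  obtain ⟨t', ht'⟩ := ht.mem_range_tor (m := (uni f)⁻¹ * ψ (inr s') * uni f) (by
    have h3 : (tor t : Hol p Γ) = (uni f)⁻¹ * ψ (inr s) * uni f := by
      rw [h2, ← hf]; group
    have h4 : Commute (ψ (inr s')) (ψ (inr s)) :=
      ((Commute.all s' s).map (inr : _ →* TorusGroup p Γ)).map ψ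
    rw [h3]
    simpa using h4.conj (uni f)⁻¹)
  exact ⟨t', ht'.symm⟩

/-- An embedding of the extended graph group has the extended graph group as its image. -/
theorem range_eq_range_inl (hp : (Nat.card (Γ ≃g Γ)).Coprime p) {ℓ : ℕ}
    (hl : (Nat.card (Γ ≃g Γ)).Coprime ℓ) {t : V → (ZMod p)ˣ} (ht : IsRegular t) (htl : t ^ ℓ = 1)
    (hψ : Function.Injective ψ) : ψ.range = (inl : TorusGroup p Γ →* Hol p Γ).range := by
  refine Subgroup.eq_of_le_of_card_ge ?_ ?_
  · rintro _ ⟨n, rfl⟩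
    obtain ⟨f, hf⟩ := exists_conj_map_inr hp hl ht htl hψ
    obtain ⟨s, hs⟩ := hf n.right
    obtain ⟨b, hb⟩ := exists_map_inl_eq_uni hp ψ n.left
    have h : ψ (inr n.right) = uni f * tor s * (uni f)⁻¹ := by rw [← hs]; group
    refine ⟨inl b * (inl f * inr s * (inl f)⁻¹), ?_⟩
    rw [← inl_left_mul_inr_right n, map_mul ψ, hb, h]
    simp [uni, tor]
  · rw [Nat.card_congr (MonoidHom.ofInjective hψ).symm.toEquiv,
      Nat.card_congr (MonoidHom.ofInjective (inl_injective (φ := isoAut p Γ))).symm.toEquiv]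

end TorusGroup

/-! ### Automorphisms of the graph group normalising the torus. -/

namespace GraphGroup

variable {p : ℕ} {V : Type u} {Γ : SimpleGraph V}

theorem commute_iff_not_adj [Fact p.Prime] (hp : 2 < p) {a b : GraphGroup p Γ} {u v : V}
    (ha : ∀ w, a.x w ≠ 0 ↔ w = u) (hb : ∀ w, b.x w ≠ 0 ↔ w = v) :
    Commute a b ↔ ¬ Γ.Adj u v := by
  have h2 := two_ne_zero_zmod hp
  rw [← commutatorElement_eq_one_iff_commute]
  constructor
  · intro h huv
    have h1 := commutator_y a b u v
    have hau : a.x v = 0 := by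
      by_contra h
      exact huv.ne ((ha v).1 h).symm
    rw [h, one_y, wt_of_adj huv, hau, one_mul, mul_zero, sub_zero] at h1
    exact mul_ne_zero h2 (mul_ne_zero ((ha u).2 rfl) ((hb v).2 rfl)) h1.symm
  · intro h
    refine ext' (commutator_x a b) fun c d => ?_
    rw [commutator_y, one_y]
    by_cases hcd : Γ.Adj c d
    · have h1 : ∀ c d, Γ.Adj c d → a.x c * b.x d = 0 := by
        intro c d hcd
        by_contra hne
        rw [(ha c).1 (left_ne_zero_of_mul hne), (hb d).1 (right_ne_zero_of_mul hne)] at hcd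
        exact h hcd
      rw [h1 c d hcd, mul_comm (b.x c), h1 d c hcd.symm]
      simp
    · rw [wt_of_not_adj hcd]; simp

theorem torusAct_gen [NeZero p] (t : V → (ZMod p)ˣ) (v : V) :
    torusAct p Γ t (gen v) = gen v ^ (t v : ZMod p).val := by
  refine ext' (fun u => ?_) (fun a b => by simp)
  rw [torusAct_x, pow_x, ZMod.natCast_zmod_val]
  by_cases h : u = v
  · rw [h]
  · rw [gen_x_of_ne h, mul_zero, mul_zero]

/-- Distinct coordinate characters differ at the element with `-1` in one place, as `p` is odd. -/
theorem torus_separates [Fact p.Prime] (hp : 2 < p) {u v : V}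
    (h : ∀ t : V → (ZMod p)ˣ, t u = t v) : u = v := by
  classical
  by_contra hne
  have h1 := h (Pi.mulSingle u (-1))
  rw [Pi.mulSingle_eq_same, Pi.mulSingle_eq_of_ne (Ne.symm hne)] at h1
  have : Fact (2 < p) := ⟨hp⟩
  exact ZMod.neg_one_ne_one (congrArg Units.val h1)

variable [Finite V] [Fact p.Prime]

/-- An automorphism of the graph group that normalises the torus permutes the lines spanned by the
generators. -/
theorem exists_map_gen (hp : 2 < p) (β : MulAut (GraphGroup p Γ))
    (τ : (V → (ZMod p)ˣ) → (V → (ZMod p)ˣ)) (hτ : Function.Surjective τ)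
    (h : ∀ t a, β (torusAct p Γ t a) = torusAct p Γ (τ t) (β a)) (v : V) :
    ∃ u, (∀ w, (β (gen v)).x w ≠ 0 ↔ w = u) ∧ (∀ b c, (β (gen v)).y b c = 0) ∧
      ∀ t, τ t u = t v := by
  -- The image of a generator is an eigenvector of `τ t` with eigenvalue `t v`.
  have key : ∀ t, torusAct p Γ (τ t) (β (gen v)) = β (gen v) ^ (t v : ZMod p).val := by
    intro t
    rw [← h, torusAct_gen, map_pow]
  have hx : ∀ t w, (β (gen v)).x w ≠ 0 → τ t w = t v := by
    intro t w hw
    have h1 := congrFun (congrArg GraphGroup.x (key t)) w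
    rw [torusAct_x, pow_x, ZMod.natCast_zmod_val] at h1
    exact Units.ext (mul_right_cancel₀ hw h1)
  obtain ⟨u, hu⟩ : ∃ u, (β (gen v)).x u ≠ 0 := by
    by_contra! hne
    have := map_x_eq_zero hp β.symm.toMonoidHom hne v
    simp [gen_x_self] at this
  refine ⟨u, fun w => ⟨fun hw => ?_, fun hw => hw ▸ hu⟩, fun b c => ?_, fun t => hx t u hu⟩
  · refine torus_separates hp fun s => ?_
    obtain ⟨t, rfl⟩ := hτ s
    rw [hx t w hw, hx t u hu]
  · by_contra hne
    -- The constant `-1` acts by `-1` on the vector part and by `1` on the forms, so an eigenvector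
    -- with nonzero vector part has no form part.
    obtain ⟨t, ht⟩ := hτ fun _ => -1
    have h1 := congrFun (congrFun (congrArg GraphGroup.y (key t)) b) c
    rw [torusAct_y, pow_y, ZMod.natCast_zmod_val, ← hx t u hu, ht] at h1
    have h2 := mul_right_cancel₀ hne h1
    have : Fact (2 < p) := ⟨hp⟩
    refine ZMod.neg_one_ne_one (n := p) ?_
    simpa using h2.symm

/-- The permutation of the generator lines preserves commutation, hence adjacency; the scalars on
the lines form the torus element. -/
theorem exists_torus_iso (hp : 2 < p) (β : MulAut (GraphGroup p Γ))
    (τ : (V → (ZMod p)ˣ) → (V → (ZMod p)ˣ)) (hτ : Function.Surjective τ)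
    (h : ∀ t a, β (torusAct p Γ t a) = torusAct p Γ (τ t) (β a)) :
    ∃ (t : V → (ZMod p)ˣ) (σ : Γ ≃g Γ), (∀ a, β a = torusAct p Γ t (isoAct p Γ σ a)) ∧
      ∀ s, τ s = isoTorus p Γ σ s := by
  choose π hπx hπy hπ using exists_map_gen hp β τ hτ h
  have hinj : Function.Injective π := by
    intro v v' hv
    refine torus_separates hp fun t => ?_
    exact (hπ v t).symm.trans (hv ▸ hπ v' t)
  let e : V ≃ V := Equiv.ofBijective π (Finite.injective_iff_bijective.1 hinj)
  have hgen : ∀ v w, (gen v : GraphGroup p Γ).x w ≠ 0 ↔ w = v := by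
    intro v w
    by_cases hvw : w = v
    · simp [hvw, gen_x_self]
    · simp [hvw, gen_x_of_ne hvw]
  let σ : Γ ≃g Γ :=
    { toEquiv := e
      map_rel_iff' := by
        intro u v
        change Γ.Adj (π u) (π v) ↔ Γ.Adj u v
        rw [← not_iff_not, ← commute_iff_not_adj hp (hπx u) (hπx v),
          ← commute_iff_not_adj hp (hgen u) (hgen v)]
        exact ⟨fun h => by simpa using h.map β.symm, fun h => h.map β⟩ }
  have hσ : ∀ v, σ v = π v := fun _ => rfl
  have hne : ∀ u, (β (gen (σ.symm u))).x u ≠ 0 := by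
    intro u
    rw [hπx, ← hσ, σ.apply_symm_apply]
  let t : V → (ZMod p)ˣ := fun u => Units.mk0 _ (hne u)
  refine ⟨t, σ, fun a => ?_, fun s => ?_⟩
  · have hhom : β.toMonoidHom =
        ((torusAct p Γ t).toMonoidHom).comp (isoAct p Γ σ).toMonoidHom := by
      refine hom_ext hp fun v => ?_
      change β (gen v) = torusAct p Γ t (isoAct p Γ σ (gen v))
      rw [isoAct_gen]
      refine ext' (fun w => ?_) fun b c => by rw [hπy, torusAct_y, gen_y, mul_zero]
      rw [torusAct_x]
      by_cases hw : w = σ v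
      · subst hw
        simp [t, gen_x_self]
      · rw [gen_x_of_ne hw, mul_zero]
        by_contra hc
        exact hw ((hπx v w).1 hc)
    exact DFunLike.congr_fun hhom a
  · funext u
    rw [isoTorus_apply, ← hπ (σ.symm u) s, ← hσ, σ.apply_symm_apply]

end GraphGroup

/-! ### The automorphism group of `TorusGroup`. -/

namespace TorusGroup

open GraphGroup

variable {p : ℕ} {V : Type u} {Γ : SimpleGraph V} [Finite V] [Fact p.Prime]

theorem exists_eq_conj_inr_mul_isoAut (hp : 2 < p) (φ : MulAut (TorusGroup p Γ))
    (hF : ∀ a, ∃ b, φ (inl a) = inl b) (hT : ∀ s, ∃ s', φ (inr s) = inr s') :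
    ∃ t σ, φ = MulAut.conj (inr t) * isoAut p Γ σ := by
  choose β hβ using hF
  choose τ hτ using hT
  have hβinj : Function.Injective β := fun a b h =>
    inl_injective (φ.injective (by rw [hβ, hβ, h]))
  have hτinj : Function.Injective τ := fun a b h =>
    inr_injective (φ.injective (by rw [hτ, hτ, h]))
  let β' : MulAut (GraphGroup p Γ) :=
    MulEquiv.mk' (Equiv.ofBijective β (Finite.injective_iff_bijective.1 hβinj)) fun a b =>
      inl_injective (φ := torusAct p Γ) (by
        change inl (β (a * b)) = inl (β a * β b)
        rw [map_mul, ← hβ, ← hβ, ← hβ, map_mul, map_mul])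
  obtain ⟨t, σ, h1, h2⟩ := exists_torus_iso hp β' τ (Finite.surjective_of_injective hτinj) (by
    intro s a
    refine inl_injective (φ := torusAct p Γ) ?_
    change inl (β (torusAct p Γ s a)) = inl (torusAct p Γ (τ s) (β a))
    rw [← hβ, inl_aut, inl_aut, map_mul, map_mul, hβ, hτ, hτ]
    congr 2
    refine inr_injective (φ := torusAct p Γ) ?_
    rw [← hτ, map_inv, map_inv, map_inv, hτ])
  refine ⟨t, σ, MulEquiv.toMonoidHom_injective (SemidirectProduct.hom_ext ?_ ?_)⟩
  · ext1 a
    change φ (inl a) = inr t * inl (isoAct p Γ σ a) * (inr t)⁻¹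
    rw [hβ, ← map_inv, ← inl_aut, ← h1]
    rfl
  · ext1 s
    change φ (inr s) = inr t * inr (isoTorus p Γ σ s) * (inr t)⁻¹
    rw [hτ, ← map_inv, ← map_mul, ← map_mul, h2, mul_comm t, mul_inv_cancel_right]

/-- Composed with `inl`, `φ` is an embedding into `Hol`, so conjugating by some `f` makes it
preserve the graph group and the torus. -/
theorem exists_eq_conj_mul_isoAut (hp2 : 2 < p) (hp : (Nat.card (Γ ≃g Γ)).Coprime p) {ℓ : ℕ}
    (hl : (Nat.card (Γ ≃g Γ)).Coprime ℓ) {t : V → (ZMod p)ˣ} (ht : IsRegular t) (htl : t ^ ℓ = 1)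
    (φ : MulAut (TorusGroup p Γ)) : ∃ n σ, φ = MulAut.conj n * isoAut p Γ σ := by
  have hψ : Function.Injective ((inl : TorusGroup p Γ →* Hol p Γ).comp φ.toMonoidHom) :=
    inl_injective.comp φ.injective
  obtain ⟨f, hf⟩ := exists_conj_map_inr hp hl ht htl hψ
  have hF := exists_map_inl_eq_uni hp ((inl : TorusGroup p Γ →* Hol p Γ).comp φ.toMonoidHom)
  obtain ⟨t, σ, h⟩ := exists_eq_conj_inr_mul_isoAut hp2 (MulAut.conj (inl f)⁻¹ * φ) (by
    intro a
    obtain ⟨b, hb⟩ := hF a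
    have hb' : φ (inl a) = inl b := inl_injective hb
    refine ⟨f⁻¹ * b * f, ?_⟩
    simp [MulAut.mul_apply, hb']) (by
    intro s
    obtain ⟨s', hs'⟩ := hf s
    refine ⟨s', inl_injective (φ := isoAut p Γ) (Eq.trans ?_ hs')⟩
    simp [MulAut.mul_apply, uni])
  refine ⟨inl f * inr t, σ, ?_⟩
  rw [map_mul, mul_assoc, ← h, ← mul_assoc, ← map_mul, mul_inv_cancel, map_one, one_mul]

end TorusGroup

namespace TorusGroup

open GraphGroup

variable {p : ℕ} {V : Type u} {Γ : SimpleGraph V} [Fact p.Prime]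

/-- A central element commutes with `t`, hence lies in the torus, which acts faithfully on the graph
group. -/
theorem center_eq_bot {t : V → (ZMod p)ˣ} (ht : IsRegular t) :
    Subgroup.center (TorusGroup p Γ) = ⊥ := by
  refine (Subgroup.eq_bot_iff_forall _).2 fun n hn => ?_
  have hcomm : ∀ m, Commute n m := fun m => (Subgroup.mem_center_iff.1 hn m).symm
  obtain ⟨s, hs⟩ := ht.mem_range_tor (m := inl n) ((hcomm (inr t)).map (inl : _ →* Hol p Γ))
  have hs' : inr s = n := inl_injective hs
  have h1 : torusAct p Γ s = torusAct p Γ 1 := by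
    ext1 a
    refine inl_injective (φ := torusAct p Γ) ?_
    rw [inl_aut, map_one, hs', (hcomm (inl a)).eq, ← hs', mul_assoc, ← map_mul, mul_inv_cancel,
      map_one, mul_one]
    rfl
  rw [← hs', torusAct_injective h1, map_one]

/-- Inner automorphisms are trivial on the abelian quotient torus, while `σ` permutes the distinct
coordinates of `t`. -/
theorem eq_one_of_isoAut_mem_innerAut {t : V → (ZMod p)ˣ} (ht : IsRegular t) {σ : Γ ≃g Γ}
    (h : isoAut p Γ σ ∈ InnerAut (TorusGroup p Γ)) : σ = 1 := by
  obtain ⟨n, hn⟩ := h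
  have h1 := congrArg SemidirectProduct.right (DFunLike.congr_fun hn (inr t))
  simp only [MulAut.conj_apply, mul_right, right_inr, inv_right, isoAut_right] at h1
  rw [mul_comm n.right, mul_inv_cancel_right] at h1
  refine RelIso.ext fun v => ?_
  have h2 := congrFun h1 (σ v)
  rw [isoTorus_apply, σ.symm_apply_apply] at h2
  exact ht.injective h2

theorem conj_injective {t : V → (ZMod p)ˣ} (ht : IsRegular t) :
    Function.Injective (MulAut.conj : TorusGroup p Γ →* MulAut (TorusGroup p Γ)) := by
  refine (injective_iff_map_eq_one _).2 fun n h => ?_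
  have hn : n ∈ Subgroup.center (TorusGroup p Γ) := Subgroup.mem_center_iff.2 fun m => by
    have := DFunLike.congr_fun h m
    rw [MulAut.conj_apply, MulAut.one_apply, mul_inv_eq_iff_eq_mul] at this
    exact this.symm
  rwa [center_eq_bot ht, Subgroup.mem_bot] at hn

variable [Finite V]

theorem exists_mulEquiv_mulAut (hp2 : 2 < p) (hp : (Nat.card (Γ ≃g Γ)).Coprime p) {ℓ : ℕ}
    (hl : (Nat.card (Γ ≃g Γ)).Coprime ℓ) {t : V → (ZMod p)ˣ} (ht : IsRegular t)
    (htl : t ^ ℓ = 1) :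
    ∃ e : Hol p Γ ≃* MulAut (TorusGroup p Γ),
      (∀ n, e (inl n) = MulAut.conj n) ∧ ∀ σ, e (inr σ) = isoAut p Γ σ := by
  have hc : ∀ σ : Γ ≃g Γ, MulAut.conj.comp (isoAut p Γ σ).toMonoidHom =
      (MulAut.conj (isoAut p Γ σ)).toMonoidHom.comp MulAut.conj := fun σ => by
    ext n m : 2
    simp [MulAut.mul_apply]
  let f : Hol p Γ →* MulAut (TorusGroup p Γ) := lift MulAut.conj (isoAut p Γ) hc
  have hf : Function.Bijective f := by
    constructor
    · refine (injective_iff_map_eq_one f).2 ?_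
      rintro ⟨n, σ⟩ h
      rw [mk_eq_inl_mul_inr, map_mul, lift_inl, lift_inr] at h
      have hσ : σ = 1 := eq_one_of_isoAut_mem_innerAut ht
        ⟨n⁻¹, by rw [map_inv]; exact inv_eq_of_mul_eq_one_right h⟩
      rw [hσ, map_one, mul_one] at h
      rw [conj_injective ht (h.trans (map_one _).symm), hσ]
      rfl
    · intro φ
      obtain ⟨n, σ, rfl⟩ := exists_eq_conj_mul_isoAut hp2 hp hl ht htl φ
      exact ⟨inl n * inr σ, by rw [map_mul, lift_inl, lift_inr]⟩
  exact ⟨MulEquiv.ofBijective f hf, lift_inl _ _ hc, lift_inr _ _ hc⟩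

/-- Under the isomorphism with `Hol`, an isomorphic copy of `TorusGroup` is the image of an
embedding, and `InnerAut` is the range of `inl`. -/
theorem nonempty_mulEquiv_iff (hp2 : 2 < p) (hp : (Nat.card (Γ ≃g Γ)).Coprime p) {ℓ : ℕ}
    (hl : (Nat.card (Γ ≃g Γ)).Coprime ℓ) {t : V → (ZMod p)ˣ} (ht : IsRegular t)
    (htl : t ^ ℓ = 1) (H : Subgroup (MulAut (TorusGroup p Γ))) :
    Nonempty (H ≃* TorusGroup p Γ) ↔ H = InnerAut (TorusGroup p Γ) := by
  constructor
  · rintro ⟨i⟩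
    obtain ⟨e, he, -⟩ := exists_mulEquiv_mulAut hp2 hp hl ht htl
    let ψ : TorusGroup p Γ →* Hol p Γ :=
      e.symm.toMonoidHom.comp (H.subtype.comp i.symm.toMonoidHom)
    have hψ : Function.Injective ψ :=
      e.symm.injective.comp (H.subtype_injective.comp i.symm.injective)
    have hr := congrArg (Subgroup.map e.toMonoidHom) (range_eq_range_inl hp hl ht htl hψ)
    rw [MonoidHom.map_range, MonoidHom.map_range] at hr
    have h1 : e.toMonoidHom.comp ψ = H.subtype.comp i.symm.toMonoidHom := by
      ext1 n
      exact e.apply_symm_apply _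
    have h2 : e.toMonoidHom.comp inl = MulAut.conj := MonoidHom.ext he
    rw [h1, h2, MonoidHom.range_comp, MonoidHom.range_eq_top.2 i.symm.surjective,
      ← MonoidHom.range_eq_map, Subgroup.range_subtype] at hr
    exact hr
  · rintro rfl
    exact ⟨(MonoidHom.ofInjective (conj_injective ht)).symm⟩

theorem mk_comp_isoAut_bijective (hp2 : 2 < p) (hp : (Nat.card (Γ ≃g Γ)).Coprime p) {ℓ : ℕ}
    (hl : (Nat.card (Γ ≃g Γ)).Coprime ℓ) {t : V → (ZMod p)ˣ} (ht : IsRegular t)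
    (htl : t ^ ℓ = 1) :
    Function.Bijective
      ((QuotientGroup.mk' (InnerAut (TorusGroup p Γ))).comp (isoAut p Γ)) := by
  constructor
  · refine (injective_iff_map_eq_one _).2 fun σ h => ?_
    exact eq_one_of_isoAut_mem_innerAut ht ((QuotientGroup.eq_one_iff _).1 h)
  · intro q
    obtain ⟨φ, rfl⟩ := QuotientGroup.mk'_surjective _ q
    obtain ⟨n, σ, rfl⟩ := exists_eq_conj_mul_isoAut hp2 hp hl ht htl φ
    have h : QuotientGroup.mk' (InnerAut (TorusGroup p Γ)) (MulAut.conj n) = 1 :=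
      (QuotientGroup.eq_one_iff _).2 ⟨n, rfl⟩
    exact ⟨σ, by rw [map_mul, h, one_mul]; rfl⟩

end TorusGroup

/-! ### Choice of the primes. -/

/-- A torus over a suitable prime field contains a regular element of prime order. -/
theorem exists_isRegular (V : Type u) [Finite V] {m : ℕ} (hm : m ≠ 0) :
    ∃ (p : ℕ) (_ : Fact p.Prime), 2 < p ∧ m.Coprime p ∧
      ∃ ℓ, m.Coprime ℓ ∧ ∃ t : V → (ZMod p)ˣ, TorusGroup.IsRegular t ∧ t ^ ℓ = 1 := by
  have hcop : ∀ q, q.Prime → m < q → m.Coprime q := fun q hq h =>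
    ((Nat.Prime.coprime_iff_not_dvd hq).2 fun hd =>
      absurd (Nat.le_of_dvd (Nat.pos_of_ne_zero hm) hd) (not_le.2 h)).symm
  obtain ⟨N, ⟨e⟩⟩ := Finite.exists_equiv_fin V
  -- Primes above `m` are prime to `m`. The coordinates of `t` will be powers of `ζ` with exponents
  -- `1, ..., N`, whose pairwise sums stay in `2, ..., 2 * N`, below `ℓ`.
  obtain ⟨ℓ, hℓ, hℓp⟩ := Nat.exists_infinite_primes (m + 2 * N + 1)
  obtain ⟨p, hp, hpm, hmod⟩ := Nat.exists_prime_gt_modEq_one (m + 2) hℓp.ne_zero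
  have : Fact p.Prime := ⟨hp⟩
  have : Fact ℓ.Prime := ⟨hℓp⟩
  have hdvd : ℓ ∣ Fintype.card (ZMod p)ˣ := by
    rw [ZMod.card_units]
    exact (Nat.modEq_iff_dvd' hp.one_lt.le).1 hmod.symm
  obtain ⟨ζ, hζ⟩ := exists_prime_orderOf_dvd_card ℓ hdvd
  have hone : ∀ k, 0 < k → k < ℓ → ζ ^ k ≠ 1 := fun k h1 h2 h3 =>
    absurd (Nat.le_of_dvd h1 (hζ ▸ orderOf_dvd_of_pow_eq_one h3)) (not_le.2 h2)
  refine ⟨p, ⟨hp⟩, by omega, hcop p hp (by omega), ℓ, hcop ℓ hℓp (by omega),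
    fun v => ζ ^ ((e v : ℕ) + 1), ⟨fun u => ?_, fun u v => ?_, fun u v h => ?_⟩, ?_⟩
  · have := (e u).isLt
    exact hone _ (by omega) (by omega)
  · have := (e u).isLt
    have := (e v).isLt
    change ζ ^ _ * ζ ^ _ ≠ 1
    rw [← pow_add]
    exact hone _ (by omega) (by omega)
  · have h1 := (e u).isLt
    have h2 := (e v).isLt
    have h3 := pow_injOn_Iio_orderOf (x := ζ) (by rw [hζ]; exact Set.mem_Iio.2 (by omega))
      (by rw [hζ]; exact Set.mem_Iio.2 (by omega)) h
    exact e.injective (Fin.ext (Nat.succ_injective h3))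
  · funext v
    change (ζ ^ _) ^ ℓ = 1
    rw [← pow_mul, mul_comm, pow_mul, ← hζ, pow_orderOf_eq_one, one_pow]

/-! ### Supersolvability. -/

/-- `K` is obtained from `H` by a normal cyclic extension. -/
def CyclicStep {N : Type u} [Group N] (H K : Subgroup N) : Prop :=
  K.Normal ∧ H ≤ K ∧ ∃ _ : H.Normal, IsCyclic (K ⧸ H.subgroupOf K)

theorem isSupersolvable_of_reflTransGen {N : Type u} [Group N]
    (h : Relation.ReflTransGen CyclicStep (⊥ : Subgroup N) ⊤) : IsSupersolvable N := by
  have key : ∀ K : Subgroup N, Relation.ReflTransGen CyclicStep ⊥ K →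
      ∃ (n : ℕ) (H : Fin (n + 1) → Subgroup N), (∀ i, (H i).Normal) ∧
        H 0 = ⊥ ∧ H (Fin.last n) = K ∧ ∀ i : Fin n, CyclicStep (H i.castSucc) (H i.succ) := by
    intro K hK
    induction hK with
    | refl => exact ⟨0, fun _ => ⊥, fun _ => inferInstance, rfl, rfl, fun i => i.elim0⟩
    | @tail L K _ hLK ih =>
      obtain ⟨n, H, hn, h0, hl, hs⟩ := ih
      refine ⟨n + 1, Fin.snoc (α := fun _ => Subgroup N) H K, fun i => ?_, ?_, by simp,
        fun i => ?_⟩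
      · induction i using Fin.lastCases with
        | last => rw [Fin.snoc_last]; exact hLK.1
        | cast j => rw [Fin.snoc_castSucc]; exact hn j
      · rw [← Fin.castSucc_zero, Fin.snoc_castSucc, h0]
      · induction i using Fin.lastCases with
        | last =>
          rw [Fin.succ_last, Fin.snoc_last, Fin.snoc_castSucc, hl]
          exact hLK
        | cast j =>
          rw [Fin.succ_castSucc, Fin.snoc_castSucc, Fin.snoc_castSucc]
          exact hs j
  obtain ⟨n, H, hn, h0, hl, hs⟩ := key ⊤ h
  exact ⟨n, H, hn, h0, hl, fun i => ⟨(hs i).2.1, (hs i).2.2.2⟩⟩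

theorem cyclicStep_sup_zpowers {N : Type u} [Group N] {H : Subgroup N} [H.Normal] {z : N}
    (hz : ∀ n, n * z * n⁻¹ ∈ H ⊔ Subgroup.zpowers z) :
    CyclicStep H (H ⊔ Subgroup.zpowers z) := by
  refine ⟨⟨fun x hx n => ?_⟩, le_sup_left, inferInstance, ?_⟩
  · have hle : H ⊔ Subgroup.zpowers z ≤
        (H ⊔ Subgroup.zpowers z).comap (MulAut.conj n).toMonoidHom := by
      refine sup_le (fun y hy => ?_) ((Subgroup.zpowers_le).2 (hz n))
      exact Subgroup.mem_sup_left (Subgroup.Normal.conj_mem inferInstance y hy n)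
    exact hle hx
  · set K := H ⊔ Subgroup.zpowers z
    have hzK : z ∈ K := Subgroup.mem_sup_right (Subgroup.mem_zpowers z)
    refine ⟨((⟨z, hzK⟩ : K) : K ⧸ H.subgroupOf K), fun q => ?_⟩
    obtain ⟨⟨k, hk⟩, rfl⟩ := QuotientGroup.mk_surjective q
    obtain ⟨a, ha, b, hb, rfl⟩ := Subgroup.mem_sup_of_normal_left.1 hk
    obtain ⟨i, rfl⟩ := Subgroup.mem_zpowers_iff.1 hb
    refine ⟨i, ?_⟩
    change (((⟨z, hzK⟩ : K) ^ i : K) : K ⧸ H.subgroupOf K) = _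
    refine QuotientGroup.eq.2 (Subgroup.mem_subgroupOf.2 ?_)
    change (z ^ i)⁻¹ * (a * z ^ i) ∈ H
    have := Subgroup.Normal.conj_mem inferInstance a ha (z ^ i)⁻¹
    rwa [inv_inv, mul_assoc] at this

/-- Generators are adjoined one at a time; normality of each line modulo `H` persists modulo the
larger subgroups. -/
theorem reflTransGen_cyclicStep_sup_closure {N : Type u} [Group N] {H : Subgroup N} (hH : H.Normal)
    {S : Set N} (hS : S.Finite) (hz : ∀ z ∈ S, ∀ n, n * z * n⁻¹ ∈ H ⊔ Subgroup.zpowers z) :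
    Relation.ReflTransGen CyclicStep H (H ⊔ Subgroup.closure S) ∧
      (H ⊔ Subgroup.closure S).Normal := by
  induction S, hS using Set.Finite.induction_on with
  | empty =>
    rw [Subgroup.closure_empty, sup_bot_eq]
    exact ⟨.refl, hH⟩
  | @insert z S _ _ ih =>
    obtain ⟨h1, h2⟩ := ih fun w hw => hz w (Set.mem_insert_of_mem z hw)
    have h3 : CyclicStep (H ⊔ Subgroup.closure S)
        (H ⊔ Subgroup.closure S ⊔ Subgroup.zpowers z) :=
      cyclicStep_sup_zpowers fun n =>
        sup_le_sup_right (le_sup_left (a := H)) _ (hz z (Set.mem_insert z S) n)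
    have h4 : H ⊔ Subgroup.closure (insert z S) =
        H ⊔ Subgroup.closure S ⊔ Subgroup.zpowers z := by
      rw [Set.insert_eq, Subgroup.closure_union, Subgroup.zpowers_eq_closure, sup_assoc,
        sup_comm (Subgroup.closure S)]
    rw [h4]
    exact ⟨h1.tail h3, h3.1⟩

open GraphGroup

theorem TorusGroup.conj_inl {p : ℕ} {V : Type u} {Γ : SimpleGraph V} (n : TorusGroup p Γ)
    (a : GraphGroup p Γ) :
    n * inl a * n⁻¹ = inl (n.left * torusAct p Γ n.right a * n.left⁻¹) := by
  conv_lhs => rw [← inl_left_mul_inr_right n]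
  rw [map_mul, map_mul, inl_aut, map_inv, map_inv]
  group

theorem TorusGroup.isSupersolvable {p : ℕ} [Fact p.Prime] (hp : 2 < p) {V : Type u} [Finite V]
    (Γ : SimpleGraph V) : IsSupersolvable (TorusGroup p Γ) := by
  let E : Set (TorusGroup p Γ) := Set.range fun e : V × V => inl (edge e.1 e.2)
  let X : Set (TorusGroup p Γ) := Set.range fun v : V => inl (gen v)
  let T : Set (TorusGroup p Γ) := Set.range fun t : V → (ZMod p)ˣ => inr t
  have hE : ∀ a : GraphGroup p Γ, (∀ u, a.x u = 0) → inl a ∈ Subgroup.closure E := by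
    intro a ha
    have h1 := Subgroup.mem_map_of_mem (inl : _ →* TorusGroup p Γ) (mem_closure_edge hp ha)
    rw [MonoidHom.map_closure, ← Set.range_comp] at h1
    exact h1
  have hF : ∀ a : GraphGroup p Γ, inl a ∈ Subgroup.closure E ⊔ Subgroup.closure X := by
    intro a
    have h := eq_top_of_gen_mem hp
      (K := (Subgroup.closure E ⊔ Subgroup.closure X).comap (inl : _ →* TorusGroup p Γ))
      fun v => Subgroup.mem_sup_right (Subgroup.subset_closure ⟨v, rfl⟩)
    exact Subgroup.mem_comap.1 (h ▸ Subgroup.mem_top a)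
  -- Conjugation raises each edge element to a power, the product of two torus coordinates.
  obtain ⟨h1, h1n⟩ := reflTransGen_cyclicStep_sup_closure (N := TorusGroup p Γ) (H := ⊥)
    inferInstance (S := E) (Set.finite_range _) (by
      rintro _ ⟨⟨u, v⟩, rfl⟩ n
      refine Subgroup.mem_sup_right ?_
      have : n * inl (edge u v) * n⁻¹ =
          (inl (edge u v) : TorusGroup p Γ) ^ ((n.right u * n.right v : ZMod p)).val := by
        rw [TorusGroup.conj_inl, ← map_pow]
        refine congrArg inl (ext' (fun w => by simp) fun b c => ?_)
        have h : ∀ a d, (n.right d : ZMod p) * (gen a : GraphGroup p Γ).x d =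
            n.right a * (gen a : GraphGroup p Γ).x d := by
          intro a d
          by_cases had : d = a
          · rw [had]
          · rw [gen_x_of_ne had, mul_zero, mul_zero]
        rw [pow_y, ZMod.natCast_zmod_val]
        simp only [mul_y, mul_x, torusAct_y, torusAct_x, inv_y, inv_x, edge_y, edge_x]
        linear_combination wt p Γ b c * ((n.right c * (gen v : GraphGroup p Γ).x c) * h u b +
          n.right u * (gen u : GraphGroup p Γ).x b * h v c -
          (n.right c * (gen u : GraphGroup p Γ).x c) * h v b -
          n.right v * (gen v : GraphGroup p Γ).x b * h u c)
      exact this ▸ Subgroup.pow_mem _ (Subgroup.mem_zpowers _) _)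
  rw [bot_sup_eq] at h1 h1n
  -- Modulo the edges, conjugation raises the generator of `v` to the power given by the torus
  -- coordinate at `v`.
  obtain ⟨h2, h2n⟩ := reflTransGen_cyclicStep_sup_closure h1n (S := X) (Set.finite_range _) (by
      rintro _ ⟨v, rfl⟩ n
      have : n * inl (gen v) * n⁻¹ = inl (n.left * torusAct p Γ n.right (gen v) * n.left⁻¹ *
          (gen v ^ ((n.right v : ZMod p)).val)⁻¹) *
          (inl (gen v) : TorusGroup p Γ) ^ ((n.right v : ZMod p)).val := by
        rw [TorusGroup.conj_inl, ← map_pow, ← map_mul, inv_mul_cancel_right]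
      rw [this]
      refine Subgroup.mul_mem_sup (hE _ fun u => ?_)
        (Subgroup.pow_mem _ (Subgroup.mem_zpowers _) _)
      rw [← torusAct_gen]
      simp)
  -- Modulo the graph group, torus elements are central.
  obtain ⟨h3, -⟩ := reflTransGen_cyclicStep_sup_closure h2n (S := T) (Set.finite_range _) (by
      rintro _ ⟨t, rfl⟩ n
      have : n * inr t * n⁻¹ = inl (n.left * torusAct p Γ t n.left⁻¹) * inr t := by
        conv_lhs => rw [← inl_left_mul_inr_right n]
        have h : (inr n.right * inr t * (inr n.right)⁻¹ : TorusGroup p Γ) = inr t := by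
          rw [← map_inv, ← map_mul, ← map_mul, mul_comm n.right, mul_inv_cancel_right]
        calc inl n.left * inr n.right * inr t * (inl n.left * inr n.right)⁻¹
            = inl n.left * (inr n.right * inr t * (inr n.right)⁻¹) * (inl n.left)⁻¹ := by group
          _ = _ := by rw [h, map_mul, inl_aut, map_inv, map_inv]; group
      rw [this]
      exact Subgroup.mul_mem_sup (hF _) (Subgroup.mem_zpowers _))
  refine isSupersolvable_of_reflTransGen ?_
  convert h1.trans (h2.trans h3)
  refine ((Subgroup.eq_top_iff' _).2 fun n => ?_).symm
  rw [← inl_left_mul_inr_right n]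
  exact Subgroup.mul_mem _ (Subgroup.mem_sup_left (hF _))
    (Subgroup.mem_sup_right (Subgroup.subset_closure ⟨_, rfl⟩))

/-! ### The main theorem. -/

theorem mainTheorem4 (G : Type u) [Group G] [Finite G] :
    ∃ (N : Type u) (_ : Group N),
      Finite N ∧
      Nonempty (G ≃* OuterAut N) ∧
      Subgroup.center N = ⊥ ∧
      (∀ H : Subgroup (MulAut N), Nonempty (H ≃* N) ↔ H = InnerAut N) ∧
      (∃ s : OuterAut N →* MulAut N,
        (QuotientGroup.mk' (InnerAut N)).comp s = MonoidHom.id (OuterAut N)) ∧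
      IsSupersolvable N := by
  obtain ⟨V, _, Γ, ⟨e⟩⟩ := exists_graph_aut_equiv G
  obtain ⟨p, _, hp2, hp, ℓ, hl, t, ht, htl⟩ :=
    exists_isRegular V (m := Nat.card (Γ ≃g Γ)) Nat.card_pos.ne'
  let o : (Γ ≃g Γ) ≃* OuterAut (TorusGroup p Γ) :=
    MulEquiv.ofBijective _ (TorusGroup.mk_comp_isoAut_bijective hp2 hp hl ht htl)
  refine ⟨TorusGroup p Γ, inferInstance, inferInstance, ⟨e.trans o⟩,
    TorusGroup.center_eq_bot ht, TorusGroup.nonempty_mulEquiv_iff hp2 hp hl ht htl,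
    ⟨(TorusGroup.isoAut p Γ).comp o.symm.toMonoidHom, ?_⟩,
    TorusGroup.isSupersolvable hp2 Γ⟩
  refine MonoidHom.ext fun q => ?_
  exact o.apply_symm_apply q
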